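/- Theorem 3.3. A graphic sequence is a non-increasing sequence $\pi=(d_1,d_2,\dots,d_n)$ of nonnegative integers that is the degree sequence of some finite simple graph of order $n$ (a realization of $\pi$). For a graph $H$, a graphic sequence is potentially $H$-graphic if it has a realization that contains $H$ as a (not necessarily induced) subgraph. Let $K_5-K_3$ be the graph obtained from the complete graph $K_5$ by removing the three edges of a triangle, and let $r^t$ in a sequence mean that the term $r$ is repeated $t$ times. Let $n\ge 5$ and let $\pi=(d_1,d_2,\dots,d_n)$ be a graphic sequence without zero terms, i.e. $d_n\ge 1$. Then $\pi$ is potentially $K_5-K_3$-graphic if and only if both of the following conditions hold: (1) $d_2\ge 4$ and $d_5\ge 2$; (2) $\pi\ne(4^2,2^4)$, $\pi\ne(4^2,2^5)$, $\pi\ne(4^3,2^3)$ and $\pi\ne(4^6)$. -/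

import Mathlib

open Classical in
/-- `G`, a simple graph on the `n` vertices `Fin n`, is a realization of `d = (d_1, …, d_n)`:
its degree sequence is `d` (the term `d_i` is `d (i - 1)`, since `Fin n` starts at `0`). -/
def IsRealization {n : ℕ} (G : SimpleGraph (Fin n)) (d : Fin n → ℕ) : Prop :=
  ∀ i, G.degree i = d i

/-- `d` is a graphic sequence: a non-increasing sequence of nonnegative integers which is the
degree sequence of some simple graph of order `n`. -/
def IsGraphic {n : ℕ} (d : Fin n → ℕ) : Prop :=
  Antitone d ∧ ∃ G : SimpleGraph (Fin n), IsRealization G d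

/-- `d` is potentially `H`-graphic: it is graphic and has a realization containing `H` as a
(not necessarily induced) subgraph. -/
def IsPotentiallyGraphic {V : Type*} (H : SimpleGraph V) {n : ℕ} (d : Fin n → ℕ) : Prop :=
  Antitone d ∧ ∃ G : SimpleGraph (Fin n), IsRealization G d ∧ H.IsContained G

/-- `K_5 - K_3`: the complete graph on five vertices with the edges of a triangle (the complete
graph on the first three of the vertices) removed. -/
def K5MinusK3 : SimpleGraph (Fin 5) :=
  (⊤ : SimpleGraph (Fin 5)) \
    (⊤ : SimpleGraph (Fin 3)).map (Fin.castLEEmb (by norm_num : 3 ≤ 5))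

/-!
A copy of `K₅ - K₃` is an edge `uv` whose ends have three common neighbours. Among the realizations
in which two vertices `u`, `v` of largest degree are adjacent, take one that maximizes the degree
sum of the common neighbours of `u` and `v`. If no realization contains `K₅ - K₃`, then `u` and `v`
have private neighbours `a` and `b`. No edge exchange turns `a` or `b` into a common neighbour of
`u` and `v`, so `a` and `b` have small degree and almost the same neighbours; this leaves only
graphs whose degrees form one of the four exceptional sequences. Conversely, a realization of an
exceptional sequence has a vertex outside any copy of `K₅ - K₃`, whose degree would be too small.
-/

open Finset SimpleGraph

variable {V : Type*} {G H : SimpleGraph V}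

theorem degree_sup_of_disjoint (h : Disjoint G H) (x : V) [Fintype (G.neighborSet x)]
    [Fintype (H.neighborSet x)] [Fintype ((G ⊔ H).neighborSet x)] :
    (G ⊔ H).degree x = G.degree x + H.degree x := by
  rw [← card_neighborFinset_eq_degree, neighborFinset_sup_of_disjoint x h, card_disjUnion,
    card_neighborFinset_eq_degree, card_neighborFinset_eq_degree]

open Classical in
theorem degree_edge {s t : V} (hst : s ≠ t) (x : V) [Fintype ((edge s t).neighborSet x)] :
    (edge s t).degree x = (if x = s then 1 else 0) + (if x = t then 1 else 0) := by
  have hN : (edge s t).neighborFinset x =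
      (if x = s then {t} else ∅) ∪ (if x = t then {s} else ∅) := by
    ext y
    rw [mem_neighborFinset, edge_adj]
    grind
  rw [← card_neighborFinset_eq_degree, hN]
  grind

open Classical in
/-- Every vertex has the same degree in `G` and in `H`. -/
def SameDegrees [Fintype V] (G H : SimpleGraph V) : Prop := ∀ x, G.degree x = H.degree x

/-- The graph `G` with the edges `pq` and `rs` replaced by `pr` and `qs`. -/
def switch (G : SimpleGraph V) (p q r s : V) : SimpleGraph V :=
  G \ (edge p q ⊔ edge r s) ⊔ (edge p r ⊔ edge q s)

theorem switch_adj {p q r s x y : V} : (switch G p q r s).Adj x y ↔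
    G.Adj x y ∧ ¬((edge p q).Adj x y ∨ (edge r s).Adj x y) ∨
      (edge p r).Adj x y ∨ (edge q s).Adj x y := Iff.rfl

/-- The graph `G` with the edges `pq`, `rs`, `tw` of a closed trail `pqrstw` replaced by `qr`, `st`,
`wp`. -/
def hexagonSwitch (G : SimpleGraph V) (p q r s t w : V) : SimpleGraph V :=
  G \ (edge p q ⊔ edge r s ⊔ edge t w) ⊔ (edge q r ⊔ edge s t ⊔ edge w p)

theorem hexagonSwitch_adj {p q r s t w x y : V} : (hexagonSwitch G p q r s t w).Adj x y ↔
    G.Adj x y ∧ ¬(((edge p q).Adj x y ∨ (edge r s).Adj x y) ∨ (edge t w).Adj x y) ∨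
      ((edge q r).Adj x y ∨ (edge s t).Adj x y) ∨ (edge w p).Adj x y := Iff.rfl

theorem exists_adj_not_adj {x y w : V} [Fintype (G.neighborSet x)] [Fintype (G.neighborSet y)]
    (hle : G.degree x ≤ G.degree y) (hxw : G.Adj x w) (hyw : ¬G.Adj y w) (hwy : w ≠ y) :
    ∃ z, G.Adj y z ∧ ¬G.Adj x z ∧ z ≠ x := by
  classical
  by_contra! hall
  have hlt : #((G.neighborFinset y).erase x) < #((G.neighborFinset x).erase y) := by
    refine card_lt_card ⟨fun z hz => ?_, fun hsub => ?_⟩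
    · grind [mem_neighborFinset, G.ne_of_adj]
    · simpa [hwy, hxw, hyw] using @hsub w
  grind [card_erase_of_mem, erase_eq_of_notMem, mem_neighborFinset,
    card_neighborFinset_eq_degree, G.adj_comm]

variable [Fintype V]

theorem SameDegrees.trans {K : SimpleGraph V} (h : SameDegrees G H) (h' : SameDegrees H K) :
    SameDegrees G K := fun x => (h x).trans (h' x)

theorem sameDegrees_exchange {D E : SimpleGraph V} (hD : D ≤ G) (hE : Disjoint G E)
    (hDE : SameDegrees D E) : SameDegrees (G \ D ⊔ E) G := by
  classical
  intro x
  have hG : (G \ D ⊔ D).degree x = G.degree x := by congr!; exact sdiff_sup_cancel hD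
  rw [degree_sup_of_disjoint (hE.mono_left sdiff_le), ← hDE x, ← hG,
    degree_sup_of_disjoint disjoint_sdiff_self_left]

theorem sameDegrees_switch {p q r s : V} (hpq : G.Adj p q) (hrs : G.Adj r s)
    (hpr : ¬G.Adj p r) (hqs : ¬G.Adj q s) (npr : p ≠ r) (nqs : q ≠ s) :
    SameDegrees (switch G p q r s) G := by
  classical
  refine sameDegrees_exchange ?_ ?_ fun x => ?_
  · simp [hpq, hrs]
  · simp [disjoint_sup_right, disjoint_edge, hpr, hqs]
  · have hD : Disjoint (edge p q) (edge r s) := by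
      rw [disjoint_edge, edge_adj]; grind [hpq.ne]
    have hE : Disjoint (edge p r) (edge q s) := by
      rw [disjoint_edge, edge_adj]; grind [hpq.ne]
    rw [degree_sup_of_disjoint hD, degree_sup_of_disjoint hE, degree_edge hpq.ne,
      degree_edge hrs.ne, degree_edge npr, degree_edge nqs]
    ring

theorem sameDegrees_hexagonSwitch {p q r s t w : V} (hpq : G.Adj p q) (hrs : G.Adj r s)
    (htw : G.Adj t w) (hqr : ¬G.Adj q r) (hst : ¬G.Adj s t) (hwp : ¬G.Adj w p) (nqr : q ≠ r)
    (nst : s ≠ t) (nwp : w ≠ p) : SameDegrees (hexagonSwitch G p q r s t w) G := by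
  classical
  refine sameDegrees_exchange ?_ ?_ fun x => ?_
  · simp [hpq, hrs, htw]
  · simp [disjoint_sup_right, disjoint_edge, hqr, hst, hwp]
  · have hD₁ : Disjoint (edge p q) (edge r s) := by
      rw [disjoint_edge, edge_adj]; grind [G.adj_comm, G.ne_of_adj]
    have hD₂ : Disjoint (edge p q ⊔ edge r s) (edge t w) := by
      rw [disjoint_edge, sup_adj, edge_adj, edge_adj]; grind [G.adj_comm, G.ne_of_adj]
    have hE₁ : Disjoint (edge q r) (edge s t) := by
      rw [disjoint_edge, edge_adj]; grind [G.adj_comm, G.ne_of_adj]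
    have hE₂ : Disjoint (edge q r ⊔ edge s t) (edge w p) := by
      rw [disjoint_edge, sup_adj, edge_adj, edge_adj]; grind [G.adj_comm, G.ne_of_adj]
    rw [degree_sup_of_disjoint hD₂, degree_sup_of_disjoint hD₁, degree_sup_of_disjoint hE₂,
      degree_sup_of_disjoint hE₁, degree_edge hpq.ne, degree_edge hrs.ne, degree_edge htw.ne,
      degree_edge nqr, degree_edge nst, degree_edge nwp]
    ring

open Classical in
/-- The set of common neighbours of two vertices, as a finset. -/
noncomputable def commonNeighborFinset (G : SimpleGraph V) (u v : V) : Finset V :=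
  G.neighborFinset u ∩ G.neighborFinset v

theorem mem_commonNeighborFinset {u v x : V} :
    x ∈ commonNeighborFinset G u v ↔ G.Adj u x ∧ G.Adj v x := by
  simp [commonNeighborFinset]

theorem commonNeighborFinset_comm (u v : V) :
    commonNeighborFinset G u v = commonNeighborFinset G v u := by
  classical exact inter_comm _ _

open Classical in
/-- `uv` is an edge whose common neighbours have the largest degree sum possible among the graphs
with the degrees of `G` in which `uv` is an edge. -/
structure IsOptimal (G : SimpleGraph V) (u v : V) : Prop where
  adj : G.Adj u v
  sum_le : ∀ H, SameDegrees H G → H.Adj u v →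
    ∑ w ∈ commonNeighborFinset H u v, G.degree w ≤ ∑ w ∈ commonNeighborFinset G u v, G.degree w

section Optimal

variable {u v x : V}

theorem IsOptimal.symm (h : IsOptimal G u v) : IsOptimal G v u where
  adj := h.adj.symm
  sum_le H hH hvu := by
    simpa only [commonNeighborFinset_comm v u] using h.sum_le H hH hvu.symm

theorem exists_isOptimal (h : G.Adj u v) : ∃ H, SameDegrees H G ∧ IsOptimal H u v := by
  classical
  obtain ⟨H, ⟨hH, huv⟩, hmax⟩ := Set.exists_max_image {H | SameDegrees H G ∧ H.Adj u v}
    (fun H => ∑ w ∈ commonNeighborFinset H u v, G.degree w) (Set.toFinite _)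
    ⟨G, fun _ => rfl, h⟩
  refine ⟨H, hH, huv, fun K hK hKuv => ?_⟩
  simpa only [hH _] using hmax K ⟨hK.trans hH, hKuv⟩

theorem IsOptimal.of_subset (h : IsOptimal G u v) (hH : SameDegrees H G) (huv : H.Adj u v)
    (hsub : commonNeighborFinset G u v ⊆ commonNeighborFinset H u v) : IsOptimal H u v where
  adj := huv
  sum_le K hK hKuv := by
    simp only [hH _]
    exact (h.sum_le K (hK.trans hH) hKuv).trans (sum_le_sum_of_subset hsub)

theorem IsOptimal.commonNeighborFinset_subset (h : IsOptimal G u v) (hH : SameDegrees H G)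
    (huv : H.Adj u v) (hsub : commonNeighborFinset G u v ⊆ commonNeighborFinset H u v) :
    commonNeighborFinset H u v ⊆ commonNeighborFinset G u v := by
  classical
  intro x hx
  by_contra hxG
  refine (h.sum_le H hH huv).not_gt (sum_lt_sum_of_subset hsub hx hxG ?_ fun _ _ _ => Nat.zero_le _)
  rw [← hH x, degree_pos_iff_exists_adj]
  exact ⟨u, (mem_commonNeighborFinset.1 hx).1.symm⟩

open Classical in
theorem IsOptimal.degree_le_degree (h : IsOptimal G u v) (hH : SameDegrees H G)
    (huv : H.Adj u v) {c : V} (hc : c ∈ commonNeighborFinset G u v)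
    (hsub : (commonNeighborFinset G u v).erase c ⊆ commonNeighborFinset H u v)
    (hx : x ∈ commonNeighborFinset H u v) (hxG : x ∉ commonNeighborFinset G u v) :
    G.degree x ≤ G.degree c := by
  have hle := (sum_le_sum_of_subset (f := fun w => G.degree w) (insert_subset hx hsub)).trans
    (h.sum_le H hH huv)
  rw [sum_insert (by simp [hxG]), ← sum_erase_add _ _ hc] at hle
  omega

end Optimal

/-- The edge `uv` is optimal, and `a` and `b` are private neighbours of `u` and `v`: each is
adjacent to just that one of the two. -/
structure IsPrivatePair (G : SimpleGraph V) (u v a b : V) : Prop where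
  optimal : IsOptimal G u v
  adj_left : G.Adj u a
  not_adj_left : ¬G.Adj v a
  ne_left : a ≠ v
  adj_right : G.Adj v b
  not_adj_right : ¬G.Adj u b
  ne_right : b ≠ u

namespace IsPrivatePair

variable {u v a b x y z : V}

theorem symm (h : IsPrivatePair G u v a b) : IsPrivatePair G v u b a where
  optimal := h.optimal.symm
  adj_left := h.adj_right
  not_adj_left := h.not_adj_right
  ne_left := h.ne_right
  adj_right := h.adj_left
  not_adj_right := h.not_adj_left
  ne_right := h.ne_left

theorem ne (h : IsPrivatePair G u v a b) : a ≠ b := by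
  rintro rfl
  exact h.not_adj_left h.adj_right

theorem not_adj_of_sameDegrees (h : IsPrivatePair G u v a b) (hH : SameDegrees H G)
    (hu : ∀ w, G.Adj u w → H.Adj u w) (hv : ∀ w ≠ b, G.Adj v w → H.Adj v w) : ¬H.Adj v a := by
  intro hva
  have hsub : commonNeighborFinset G u v ⊆ commonNeighborFinset H u v := fun w hw => by
    rw [mem_commonNeighborFinset] at hw ⊢
    exact ⟨hu w hw.1, hv w (fun e => h.not_adj_right (e ▸ hw.1)) hw.2⟩
  have ha := h.optimal.commonNeighborFinset_subset hH (hu v h.optimal.adj) hsub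
    (mem_commonNeighborFinset.2 ⟨hu a h.adj_left, hva⟩)
  exact h.not_adj_left (mem_commonNeighborFinset.1 ha).2

theorem adj_of_adj (h : IsPrivatePair G u v a b) (haz : G.Adj a z) (nzu : z ≠ u)
    (nzb : z ≠ b) : G.Adj b z := by
  -- Otherwise replacing `vb`, `az` by `va`, `bz` makes `a` a further common neighbour.
  by_contra hbz
  have hH := sameDegrees_switch h.adj_right haz h.not_adj_left hbz h.ne_left.symm nzb.symm
  have ⟨_, hua, _, nav, _, _, nbu⟩ := h
  refine h.not_adj_of_sameDegrees hH ?_ ?_ ?_ <;>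
    grind [switch_adj, G.adj_comm, G.ne_of_adj]

theorem adj_left_iff (h : IsPrivatePair G u v a b) :
    G.Adj a z ↔ z = u ∨ z ∈ commonNeighborFinset G a b ∨ z = b ∧ G.Adj a b := by
  rw [mem_commonNeighborFinset]
  grind [h.adj_of_adj (z := z), h.adj_left.symm]

open Classical in
theorem degree_left (h : IsPrivatePair G u v a b) :
    G.degree a = #(commonNeighborFinset G a b) + if G.Adj a b then 2 else 1 := by
  have hN : G.neighborFinset a =
      insert u (if G.Adj a b then insert b (commonNeighborFinset G a b)
        else commonNeighborFinset G a b) := by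
    ext z
    rw [mem_neighborFinset, h.adj_left_iff]
    grind
  have hu : u ∉ commonNeighborFinset G a b := fun hu =>
    h.not_adj_right (mem_commonNeighborFinset.1 hu).2.symm
  have hb : b ∉ commonNeighborFinset G a b := fun hb =>
    G.irrefl (mem_commonNeighborFinset.1 hb).2
  rw [← card_neighborFinset_eq_degree, hN]
  grind [h.ne_right]

open Classical in
theorem degree_eq (h : IsPrivatePair G u v a b) : G.degree a = G.degree b := by
  rw [h.degree_left, h.symm.degree_left, commonNeighborFinset_comm, G.adj_comm]

open Classical in
theorem degree_left_le_of_mem (h : IsPrivatePair G u v a b) {c : V}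
    (hc : c ∈ commonNeighborFinset G u v) : G.degree a ≤ G.degree c := by
  -- Otherwise replacing `vc`, `az` by `va`, `cz` trades the common neighbour `c` for `a`.
  by_contra! hlt
  obtain ⟨huc, hvc⟩ := mem_commonNeighborFinset.1 hc
  obtain ⟨z, haz, hcz, nzc⟩ := exists_adj_not_adj hlt.le hvc.symm
    (fun e => h.not_adj_left e.symm) h.ne_left.symm
  have hH := sameDegrees_switch hvc haz h.not_adj_left hcz h.ne_left.symm nzc.symm
  have huv := h.optimal.adj
  have ⟨_, hua, hva, nav, _, _, _⟩ := h
  refine hlt.not_ge (h.optimal.degree_le_degree hH ?_ hc (fun w hw => ?_) ?_ ?_) <;>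
    grind [mem_commonNeighborFinset, switch_adj, G.adj_comm, G.ne_of_adj]

open Classical in
theorem degree_le (h : IsPrivatePair G u v a b) (nxu : x ≠ u) (nxv : x ≠ v)
    (hx : x ∉ commonNeighborFinset G u v) : G.degree x ≤ G.degree a := by
  by_cases hux : G.Adj u x
  · have hvx : ¬G.Adj v x := fun hvx => hx (mem_commonNeighborFinset.2 ⟨hux, hvx⟩)
    exact ({ h with adj_left := hux, not_adj_left := hvx, ne_left := nxv :
      IsPrivatePair G u v x b }.degree_eq.trans h.degree_eq.symm).le
  by_cases hvx : G.Adj v x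
  · exact { h with adj_right := hvx, not_adj_right := hux, ne_right := nxu :
      IsPrivatePair G u v a x }.degree_eq.ge
  -- Replacing `ua`, `xz` by `ux`, `az` makes `x` private to `u`, and `degree_eq` applies to it.
  by_contra! hlt
  obtain ⟨z, hxz, haz, nza⟩ := exists_adj_not_adj hlt.le h.adj_left.symm
    (fun e => hux e.symm) nxu.symm
  have hH := sameDegrees_switch h.adj_left hxz hux haz nxu.symm nza.symm
  have hpair : IsPrivatePair (switch G u a x z) u v x b := by
    have huv := h.optimal.adj
    have ⟨_, hua, hva, nav, hvb, hub, nbu⟩ := h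
    constructor
    · refine h.optimal.of_subset hH ?_ fun w hw => ?_ <;>
        grind [mem_commonNeighborFinset, switch_adj, G.adj_comm, G.ne_of_adj]
    all_goals grind [switch_adj, G.adj_comm, G.ne_of_adj]
  have := hpair.degree_eq
  rw [hH, hH, ← h.degree_eq] at this
  omega

theorem eq_or_adj (h : IsPrivatePair G u v a b) (hax : G.Adj a x) (nxu : x ≠ u)
    (hzy : G.Adj z y) (nyu : y ≠ u) (nyv : y ≠ v) (nzu : z ≠ u) (nzv : z ≠ v) (hbz : ¬G.Adj b z)
    (nzb : z ≠ b) : x = y ∨ G.Adj x y := by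
  by_contra! hxy
  have hH := sameDegrees_hexagonSwitch h.adj_right hzy hax.symm hbz (fun e => hxy.2 e.symm)
    (fun e => h.not_adj_left e.symm) nzb.symm hxy.1.symm h.ne_left
  have ⟨_, hua, _, nav, _, hub, nbu⟩ := h
  refine h.not_adj_of_sameDegrees hH ?_ ?_ ?_ <;>
    grind [hexagonSwitch_adj, G.adj_comm, G.ne_of_adj]

end IsPrivatePair

section Counting

variable {x y : V} {s : Finset V}

open Classical in
theorem card_le_degree (h : ∀ y ∈ s, G.Adj x y) : #s ≤ G.degree x := by
  rw [← card_neighborFinset_eq_degree]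
  exact card_le_card fun y hy => (G.mem_neighborFinset x y).2 (h y hy)

open Classical in
theorem mem_of_degree_le (h : ∀ y ∈ s, G.Adj x y) (hle : G.degree x ≤ #s) (hxy : G.Adj x y) :
    y ∈ s := by
  rw [← card_neighborFinset_eq_degree] at hle
  rw [eq_of_subset_of_card_le (fun y hy => (G.mem_neighborFinset x y).2 (h y hy)) hle]
  exact (G.mem_neighborFinset x y).2 hxy

open Classical in
theorem degree_le_card (h : ∀ y, G.Adj x y → y ∈ s) : G.degree x ≤ #s := by
  rw [← card_neighborFinset_eq_degree]
  exact card_le_card fun y hy => h y ((G.mem_neighborFinset x y).1 hy)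

open Classical in
theorem adj_of_card_le (h : ∀ y, G.Adj x y → y ∈ s) (hle : #s ≤ G.degree x) (hy : y ∈ s) :
    G.Adj x y := by
  rw [← card_neighborFinset_eq_degree] at hle
  rw [← G.mem_neighborFinset,
    eq_of_subset_of_card_le (fun y hy => h y ((G.mem_neighborFinset x y).1 hy)) hle]
  exact hy

open Classical in
theorem degree_eq_card (h : ∀ y, G.Adj x y ↔ y ∈ s) : G.degree x = #s :=
  (degree_le_card fun y => (h y).1).antisymm (card_le_degree fun y => (h y).2)

end Counting

namespace IsPrivatePair

variable {u v a b x y z : V}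

theorem mem_of_adj (h : IsPrivatePair G u v a b) (hab : G.Adj a b)
    (hzy : G.Adj z y) (nyu : y ≠ u) (nyv : y ≠ v) (nzu : z ≠ u) (nzv : z ≠ v) (hbz : ¬G.Adj b z)
    (nzb : z ≠ b) : y ∈ commonNeighborFinset G a b := by
  have hby : G.Adj b y := by
    rcases h.eq_or_adj hab h.ne_right hzy nyu nyv nzu nzv hbz nzb with rfl | hby
    · exact absurd hzy.symm hbz
    · exact hby
  have nya : y ≠ a := by
    rintro rfl
    exact hbz (h.adj_of_adj hzy.symm nzu nzb)
  exact mem_commonNeighborFinset.2 ⟨h.symm.adj_of_adj hby nyv nya, hby⟩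

open Classical in
theorem adj_of_notMem (h : IsPrivatePair G u v a b) (hab : G.Adj a b) {c : V}
    (hc : c ∈ commonNeighborFinset G u v) (hcS : c ∉ commonNeighborFinset G a b)
    (hx : x ∈ commonNeighborFinset G a b) : G.Adj c x := by
  obtain ⟨huc, hvc⟩ := mem_commonNeighborFinset.1 hc
  have nca : c ≠ a := fun e => h.not_adj_left (e ▸ hvc)
  have ncb : c ≠ b := fun e => h.not_adj_right (e ▸ huc)
  have hbc : ¬G.Adj b c := fun hbc =>
    hcS (mem_commonNeighborFinset.2 ⟨h.symm.adj_of_adj hbc hvc.ne' nca, hbc⟩)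
  refine adj_of_card_le (s := {u, v} ∪ commonNeighborFinset G a b) (fun y hcy => ?_) ?_
    (by simp [hx])
  · have := h.mem_of_adj hab hcy (z := c) (y := y)
    grind [huc.ne', hvc.ne']
  · calc #({u, v} ∪ commonNeighborFinset G a b)
      _ ≤ 2 + #(commonNeighborFinset G a b) :=
        (card_union_le _ _).trans (Nat.add_le_add_right card_le_two _)
      _ = G.degree a := by rw [h.degree_left, if_pos hab, add_comm]
      _ ≤ G.degree c := h.degree_left_le_of_mem hc

theorem mem_of_adj_left (h : IsPrivatePair G u v a b) (hab : G.Adj a b) (hux : G.Adj u x)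
    (hvx : ¬G.Adj v x) (nxv : x ≠ v) (nxa : x ≠ a) : x ∈ commonNeighborFinset G a b := by
  classical
  have h' : IsPrivatePair G u v x b :=
    { h with adj_left := hux, not_adj_left := hvx, ne_left := nxv }
  have hxb : G.Adj x b := by
    by_contra hxb
    have hsub : commonNeighborFinset G x b ⊆ commonNeighborFinset G a b := fun y hy => by
      obtain ⟨hxy, hby⟩ := mem_commonNeighborFinset.1 hy
      exact h.mem_of_adj hab hxy (fun e => h.not_adj_right (e ▸ hby.symm))
        (fun e => hvx (e ▸ hxy.symm)) hux.ne' nxv (fun e => hxb e.symm) h'.ne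
    have hdeg := h'.degree_eq.trans h.degree_eq.symm
    rw [h'.degree_left, h.degree_left, if_neg hxb, if_pos hab] at hdeg
    have := card_le_card hsub
    omega
  exact mem_commonNeighborFinset.2 ⟨h.symm.adj_of_adj hxb.symm nxv nxa, hxb.symm⟩

theorem eq_or_adj_of_mem (h : IsPrivatePair G u v a b) (hab : ¬G.Adj a b)
    (hx : x ∈ commonNeighborFinset G a b) (hy : y ∈ commonNeighborFinset G a b) :
    x = y ∨ G.Adj x y := by
  obtain ⟨hax, hbx⟩ := mem_commonNeighborFinset.1 hx
  obtain ⟨hay, hby⟩ := mem_commonNeighborFinset.1 hy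
  exact h.eq_or_adj hax (fun e => h.not_adj_right (e ▸ hbx.symm)) hay
    (fun e => h.not_adj_right (e ▸ hby.symm)) (fun e => h.not_adj_left (e ▸ hay.symm))
    h.adj_left.ne' h.ne_left (fun e => hab e.symm) h.ne

open Classical in
theorem mem_of_adj_of_notMem (h : IsPrivatePair G u v a b) (hab : ¬G.Adj a b)
    (hx : x ∈ commonNeighborFinset G a b) (hxC : x ∉ commonNeighborFinset G u v)
    (hxy : G.Adj x y) : y ∈ {a, b} ∪ commonNeighborFinset G a b := by
  obtain ⟨hax, hbx⟩ := mem_commonNeighborFinset.1 hx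
  refine union_subset_union_right (erase_subset x _)
    (mem_of_degree_le (s := {a, b} ∪ (commonNeighborFinset G a b).erase x) ?_ ?_ hxy)
  · grind [h.eq_or_adj_of_mem hab hx, G.adj_comm]
  · have := h.degree_le (fun e => h.not_adj_right (e ▸ hbx.symm))
      (fun e => h.not_adj_left (e ▸ hax.symm)) hxC
    rw [h.degree_left, if_neg hab] at this
    grind [mem_commonNeighborFinset, G.irrefl, h.ne]

theorem commonNeighborFinset_eq (h : IsPrivatePair G u v a b) (hab : ¬G.Adj a b)
    (hux : G.Adj u x) (hvx : ¬G.Adj v x) (nxv : x ≠ v) :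
    commonNeighborFinset G x b = commonNeighborFinset G a b := by
  classical
  have h' : IsPrivatePair G u v x b :=
    { h with adj_left := hux, not_adj_left := hvx, ne_left := nxv }
  have hdeg := h'.degree_eq.trans h.degree_eq.symm
  have hxb : ¬G.Adj x b := fun hxb => by
    have nxa : x ≠ a := fun e => hab (e ▸ hxb)
    have hxS := mem_commonNeighborFinset.2 ⟨h.symm.adj_of_adj hxb.symm nxv nxa, hxb.symm⟩
    have hcard : #(insert u ({a, b} ∪ (commonNeighborFinset G a b).erase x)) ≤ G.degree x := by
      refine card_le_degree ?_
      grind [h.eq_or_adj_of_mem hab hxS, mem_commonNeighborFinset, G.adj_comm]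
    rw [hdeg, h.degree_left, if_neg hab] at hcard
    grind [mem_commonNeighborFinset, G.irrefl, G.adj_comm, h.adj_left.ne, h.ne, h.ne_right,
      h.not_adj_right]
  refine eq_of_subset_of_card_le (fun y hy => ?_) ?_
  · obtain ⟨hxy, hby⟩ := mem_commonNeighborFinset.1 hy
    exact mem_commonNeighborFinset.2 ⟨h.symm.adj_of_adj hby (fun e => hvx (e ▸ hxy.symm))
      (fun e => hab (e ▸ hby.symm)), hby⟩
  · rw [h'.degree_left, h.degree_left, if_neg hab, if_neg hxb] at hdeg
    omega

open Classical in
theorem degree_lt (h : IsPrivatePair G u v a b) (hab : G.Adj a b) {c w : V}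
    (hc : c ∈ commonNeighborFinset G u v) (hcS : c ∉ commonNeighborFinset G a b)
    (hx : x ∈ commonNeighborFinset G a b) (hxw : G.Adj x w) (nwa : w ≠ a) (nwb : w ≠ b)
    (nwc : w ≠ c) (hwS : w ∉ commonNeighborFinset G a b) : G.degree a < G.degree x := by
  obtain ⟨huc, hvc⟩ := mem_commonNeighborFinset.1 hc
  obtain ⟨hax, hbx⟩ := mem_commonNeighborFinset.1 hx
  have hcx := h.adj_of_notMem hab hc hcS hx
  have nca : c ≠ a := fun e => h.not_adj_left (e ▸ hvc)
  have ncb : c ≠ b := fun e => h.not_adj_right (e ▸ huc)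
  have hbc : ¬G.Adj b c := fun hbc =>
    hcS (mem_commonNeighborFinset.2 ⟨h.symm.adj_of_adj hbc hvc.ne' nca, hbc⟩)
  have hnotMem : ∀ y ∈ commonNeighborFinset G a b, y ≠ u ∧ y ≠ v := fun y hy =>
    ⟨fun e => h.not_adj_right (e ▸ (mem_commonNeighborFinset.1 hy).2.symm),
      fun e => h.not_adj_left (e ▸ (mem_commonNeighborFinset.1 hy).1.symm)⟩
  have hclique : ∀ y ∈ commonNeighborFinset G a b, x = y ∨ G.Adj x y := fun y hy =>
    h.eq_or_adj hax (hnotMem x hx).1 (h.adj_of_notMem hab hc hcS hy) (hnotMem y hy).1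
      (hnotMem y hy).2 huc.ne' hvc.ne' hbc ncb
  have hcard : #({w, a, b, c} ∪ (commonNeighborFinset G a b).erase x) ≤ G.degree x := by
    refine card_le_degree ?_
    simp only [mem_union, mem_insert, mem_singleton, mem_erase]
    rintro y ((rfl | rfl | rfl | rfl) | ⟨nyx, hy⟩)
    exacts [hxw, hax.symm, hbx.symm, hcx.symm, (hclique y hy).resolve_left nyx.symm]
  rw [h.degree_left, if_pos hab]
  grind [mem_commonNeighborFinset, G.irrefl, h.ne, G.adj_comm]

open Classical in
theorem subset_of_mem (h : IsPrivatePair G u v a b) (hab : G.Adj a b)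
    (hux : G.Adj u x) (hvx : ¬G.Adj v x) (hx : x ∈ commonNeighborFinset G a b) :
    commonNeighborFinset G u v ⊆ commonNeighborFinset G a b := by
  intro c hc
  by_contra hcS
  have hax := (mem_commonNeighborFinset.1 hx).1
  refine (h.degree_lt hab hc hcS hx hux.symm h.adj_left.ne h.ne_right.symm
    (mem_commonNeighborFinset.1 hc).1.ne fun huS => ?_).not_ge (h.degree_le hux.ne'
      (fun e => h.not_adj_left (e ▸ hax.symm)) fun hxC => hvx (mem_commonNeighborFinset.1 hxC).2)
  exact h.not_adj_right (mem_commonNeighborFinset.1 huS).2.symm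

open Classical in
theorem eq_of_adj_left_of_adj (h : IsPrivatePair G u v a b) (hab : G.Adj a b)
    (hS : #(commonNeighborFinset G a b) ≤ 2) (hv : 4 ≤ G.degree v)
    (hux : G.Adj u x) (hvx : ¬G.Adj v x) (nxv : x ≠ v) : x = a := by
  by_contra nxa
  have hx := h.mem_of_adj_left hab hux hvx nxv nxa
  have hC := h.subset_of_mem hab hux hvx hx
  have hv' : ∀ y, G.Adj v y → y ∈ {u, b} ∪ (commonNeighborFinset G a b).erase x := fun y hvy => by
    have hyS (nyu : y ≠ u) (nyb : y ≠ b) : y ∈ commonNeighborFinset G a b := by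
      by_cases huy : G.Adj u y
      · exact hC (mem_commonNeighborFinset.2 ⟨huy, hvy⟩)
      · rw [commonNeighborFinset_comm]
        exact h.symm.mem_of_adj_left hab.symm hvy huy nyu nyb
    grind
  have := degree_le_card hv'
  grind

open Classical in
theorem eq_of_adj_left_of_not_adj (h : IsPrivatePair G u v a b) (hab : ¬G.Adj a b)
    (ha : 2 ≤ G.degree a) (hC : #(commonNeighborFinset G u v) ≤ 2)
    (hv : ∀ y ≠ u, G.degree y ≤ G.degree v)
    (hux : G.Adj u x) (hvx : ¬G.Adj v x) (nxv : x ≠ v) : x = a := by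
  by_contra nxa
  rw [h.degree_left, if_neg hab] at ha
  obtain ⟨c, hcS⟩ := card_pos.1 (by omega : 0 < #(commonNeighborFinset G a b))
  have hcx : G.Adj c x :=
    (mem_commonNeighborFinset.1 (h.commonNeighborFinset_eq hab hux hvx nxv ▸ hcS)).1.symm
  have nxb : x ≠ b := fun e => h.not_adj_right (e ▸ hux)
  have hcC : c ∈ commonNeighborFinset G u v := by
    by_contra hcC
    have hxS : x ∈ commonNeighborFinset G a b := by
      have := h.mem_of_adj_of_notMem hab hcS hcC hcx
      grind
    rw [← h.commonNeighborFinset_eq hab hux hvx nxv] at hxS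
    exact G.irrefl (mem_commonNeighborFinset.1 hxS).1
  have hcy (y : V) (hvy : G.Adj v y) (huy : ¬G.Adj u y) (nyu : y ≠ u) : G.Adj c y := by
    have := h.symm.commonNeighborFinset_eq (fun e => hab e.symm) hvy huy nyu
    rw [commonNeighborFinset_comm b a] at this
    exact (mem_commonNeighborFinset.1 (this ▸ hcS)).1.symm
  have hcard : #({v, a, x} ∪ G.neighborFinset v \ commonNeighborFinset G u v) ≤ G.degree c := by
    refine card_le_degree ?_
    grind [G.adj_comm, mem_commonNeighborFinset, mem_neighborFinset]
  have hd : Disjoint {v, a, x} (G.neighborFinset v \ commonNeighborFinset G u v) := by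
    simp [h.not_adj_left, hvx]
  rw [card_union_of_disjoint hd, card_eq_three.2 ⟨v, a, x, h.ne_left.symm, nxv.symm, Ne.symm nxa,
    rfl⟩] at hcard
  have hle := le_card_sdiff (commonNeighborFinset G u v) (G.neighborFinset v)
  rw [card_neighborFinset_eq_degree] at hle
  have := hv c (mem_commonNeighborFinset.1 hcC).1.ne'
  omega

end IsPrivatePair

/-- `G` contains `K₅ - K₃`, the book with three triangular pages: some edge lies in three
triangles. -/
def HasBook (G : SimpleGraph V) : Prop :=
  ∃ u v, G.Adj u v ∧ 3 ≤ #(commonNeighborFinset G u v)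

theorem card_commonNeighborFinset_le {u v : V} (hG : ¬HasBook G) (huv : G.Adj u v) :
    #(commonNeighborFinset G u v) ≤ 2 := by
  by_contra! hlt
  exact hG ⟨u, v, huv, hlt⟩

open Classical in
/-- `u` and `v` are hubs of degree four, the largest degree: besides each other they are adjacent
to the private neighbours `a` and `b`, respectively, and to the two common neighbours `c` and `d`.
-/
structure IsTight (G : SimpleGraph V) (u v a b c d : V) : Prop extends IsPrivatePair G u v a b where
  adj_fst_iff : ∀ x, G.Adj u x ↔ x = v ∨ x = a ∨ x = c ∨ x = d
  adj_snd_iff : ∀ x, G.Adj v x ↔ x = u ∨ x = b ∨ x = c ∨ x = d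
  ne_common : c ≠ d
  degree_le_four : ∀ x, G.degree x ≤ 4
  two_le_degree : 2 ≤ G.degree a

section Existence

variable {u v a b x : V}

open Classical in
theorem exists_adj_not_adj_of_four_le (hC : #(commonNeighborFinset G u v) ≤ 2)
    (hu : 4 ≤ G.degree u) : ∃ a, G.Adj u a ∧ ¬G.Adj v a ∧ a ≠ v := by
  by_contra! hall
  have hle : G.degree u ≤ #(insert v (commonNeighborFinset G u v)) :=
    degree_le_card fun y huy => by grind [mem_commonNeighborFinset]
  have := card_insert_le v (commonNeighborFinset G u v)
  omega

open Classical in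
theorem IsPrivatePair.two_le_degree (h : IsPrivatePair G u v a b)
    (hC : #(commonNeighborFinset G u v) ≤ 2) (h2 : 5 ≤ #{x | 2 ≤ G.degree x}) :
    2 ≤ G.degree a := by
  have hcard : #({u, v} ∪ commonNeighborFinset G u v) < #{x | 2 ≤ G.degree x} := by
    have := card_union_le {u, v} (commonNeighborFinset G u v)
    have := card_le_two (a := u) (b := v)
    omega
  obtain ⟨x, hx2, hx⟩ := exists_mem_notMem_of_card_lt_card hcard
  simp only [mem_union, mem_insert, mem_singleton, not_or] at hx
  exact (mem_filter.1 hx2).2.trans (h.degree_le hx.1.1 hx.1.2 hx.2)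

open Classical in
theorem IsPrivatePair.eq_of_adj_left (h : IsPrivatePair G u v a b) (hG : ¬HasBook G)
    (ha : 2 ≤ G.degree a) (hv4 : 4 ≤ G.degree v) (hv : ∀ y ≠ u, G.degree y ≤ G.degree v)
    (hux : G.Adj u x) (hvx : ¬G.Adj v x) (nxv : x ≠ v) : x = a := by
  by_cases hab : G.Adj a b
  · exact h.eq_of_adj_left_of_adj hab (card_commonNeighborFinset_le hG hab) hv4 hux hvx nxv
  · exact h.eq_of_adj_left_of_not_adj hab ha (card_commonNeighborFinset_le hG h.optimal.adj) hv
      hux hvx nxv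

open Classical in
theorem degree_le_of_forall_eq (ha : ∀ x, G.Adj u x → ¬G.Adj v x → x ≠ v → x = a) :
    G.degree u ≤ #(commonNeighborFinset G u v) + 2 :=
  calc G.degree u
    _ ≤ #(insert v (insert a (commonNeighborFinset G u v))) :=
      degree_le_card fun x hux => by grind [mem_commonNeighborFinset]
    _ ≤ #(commonNeighborFinset G u v) + 2 :=
      (card_insert_le _ _).trans (Nat.add_le_add_right (card_insert_le _ _) 1)

open Classical in
theorem exists_isTight (h : IsOptimal G u v) (hG : ¬HasBook G) (hu4 : 4 ≤ G.degree u)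
    (hv4 : 4 ≤ G.degree v) (hu : ∀ x ≠ v, G.degree x ≤ G.degree u)
    (hv : ∀ x ≠ u, G.degree x ≤ G.degree v) (h2 : 5 ≤ #{x | 2 ≤ G.degree x}) :
    ∃ a b c d, IsTight G u v a b c d := by
  have hC := card_commonNeighborFinset_le hG h.adj
  have hC' := commonNeighborFinset_comm (G := G) u v ▸ hC
  obtain ⟨a, hua, hva, nav⟩ := exists_adj_not_adj_of_four_le hC hu4
  obtain ⟨b, hvb, hub, nbu⟩ := exists_adj_not_adj_of_four_le hC' hv4
  have hp : IsPrivatePair G u v a b := ⟨h, hua, hva, nav, hvb, hub, nbu⟩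
  have ha2 := hp.two_le_degree hC h2
  have ha (x) := hp.eq_of_adj_left hG ha2 hv4 hv (x := x)
  have hb (x) := hp.symm.eq_of_adj_left hG (hp.degree_eq ▸ ha2) hu4 hu (x := x)
  have hu4' := degree_le_of_forall_eq ha
  have hv4' := degree_le_of_forall_eq hb
  rw [commonNeighborFinset_comm] at hv4'
  obtain ⟨c, d, ncd, hCcd⟩ : ∃ c d, c ≠ d ∧ commonNeighborFinset G u v = {c, d} :=
    card_eq_two.1 (by omega)
  have hcd (x : V) : G.Adj u x ∧ G.Adj v x ↔ x = c ∨ x = d := by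
    rw [← mem_commonNeighborFinset, hCcd, mem_insert, mem_singleton]
  refine ⟨a, b, c, d, { hp with
    adj_fst_iff := fun x => ?_
    adj_snd_iff := fun x => ?_
    ne_common := ncd
    degree_le_four := fun x => ?_
    two_le_degree := ha2 }⟩
  · grind [h.adj]
  · grind [h.adj, G.adj_comm]
  · rcases eq_or_ne x v with rfl | nxv
    · omega
    · have := hu x nxv
      omega

end Existence

/-- The sequences `(4², 2⁴)`, `(4², 2⁵)`, `(4³, 2³)` and `(4⁶)`. -/
def exceptionalSequences : List (List ℕ) :=
  [[4, 4, 2, 2, 2, 2], [4, 4, 2, 2, 2, 2, 2], [4, 4, 4, 2, 2, 2], [4, 4, 4, 4, 4, 4]]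

open Classical in
/-- The degrees of `G` form one of the `exceptionalSequences`. The comparison is by multisets, as
the vertices of `G` are not ordered by degree. -/
def IsExceptional (G : SimpleGraph V) : Prop :=
  ∃ l ∈ exceptionalSequences, univ.val.map (G.degree ·) = (l : Multiset ℕ)

open Classical in
theorem isExceptional_of_map {l : List V} (hl : l.Nodup) (hmem : ∀ x, x ∈ l)
    (hdeg : l.map (G.degree ·) ∈ exceptionalSequences) : IsExceptional G := by
  refine ⟨_, hdeg, ?_⟩
  rw [← Multiset.map_coe, (univ.nodup.ext (t := (l : Multiset V)) hl).2 fun x => by simp [hmem]]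

namespace IsTight

variable {u v a b c d x y z : V}

theorem swap (h : IsTight G u v a b c d) : IsTight G u v a b d c where
  toIsPrivatePair := h.toIsPrivatePair
  adj_fst_iff x := by rw [h.adj_fst_iff, or_comm (a := x = c)]
  adj_snd_iff x := by rw [h.adj_snd_iff, or_comm (a := x = c)]
  ne_common := h.ne_common.symm
  degree_le_four := h.degree_le_four
  two_le_degree := h.two_le_degree

theorem mem_commonNeighborFinset_iff (h : IsTight G u v a b c d) :
    x ∈ commonNeighborFinset G u v ↔ x = c ∨ x = d := by
  rw [mem_commonNeighborFinset]
  grind [h.adj_fst_iff x, h.adj_snd_iff x, h.not_adj_left, h.not_adj_right, h.optimal.adj.ne]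

theorem fst_mem (h : IsTight G u v a b c d) : c ∈ commonNeighborFinset G u v :=
  h.mem_commonNeighborFinset_iff.2 (Or.inl rfl)

theorem nodup (h : IsTight G u v a b c d) : [u, v, a, b, c, d].Nodup := by
  have := mem_commonNeighborFinset.1 h.fst_mem
  have := mem_commonNeighborFinset.1 h.swap.fst_mem
  have := h.optimal.adj
  have ⟨⟨_, hua, hva, nav, _, hub, nbu⟩, _, _, ncd, _, _⟩ := h
  simp only [List.nodup_cons, List.mem_cons, List.not_mem_nil, List.nodup_nil]
  grind [G.irrefl]

open Classical in
theorem degree_fst (h : IsTight G u v a b c d) : G.degree u = 4 := by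
  have := h.nodup
  rw [degree_eq_card (s := {v, a, c, d}) (by simp [h.adj_fst_iff])]
  grind

open Classical in
theorem degree_snd (h : IsTight G u v a b c d) : G.degree v = 4 := by
  have := h.nodup
  rw [degree_eq_card (s := {u, b, c, d}) (by simp [h.adj_snd_iff])]
  grind

theorem adj_common_iff (h : IsTight G u v a b c d) (hc : c ∈ commonNeighborFinset G a b) :
    G.Adj c y ↔ y = u ∨ y = v ∨ y = a ∨ y = b := by
  classical
  obtain ⟨huc, hvc⟩ := mem_commonNeighborFinset.1 h.fst_mem
  obtain ⟨hac, hbc⟩ := mem_commonNeighborFinset.1 hc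
  have hs : ∀ y ∈ ({u, v, a, b} : Finset V), G.Adj c y := by
    simp [huc.symm, hvc.symm, hac.symm, hbc.symm]
  have hle : G.degree c ≤ #{u, v, a, b} := by
    have := h.nodup
    have := h.degree_le_four c
    grind
  constructor
  · intro hcy
    simpa using mem_of_degree_le hs hle hcy
  · intro hy
    exact hs y (by simpa using hy)

open Classical in
theorem degree_common_of_mem (h : IsTight G u v a b c d) (hc : c ∈ commonNeighborFinset G a b) :
    G.degree c = 4 := by
  have := h.nodup
  rw [degree_eq_card (s := {u, v, a, b}) (by simp [h.adj_common_iff hc])]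
  grind

open Classical in
theorem degree_common_of_adj (h : IsTight G u v a b c d) (hc : ∀ y, G.Adj c y → y = u ∨ y = v) :
    G.degree c = 2 := by
  obtain ⟨huc, hvc⟩ := mem_commonNeighborFinset.1 h.fst_mem
  rw [degree_eq_card (s := {u, v}) fun y => ⟨by simpa using hc y, by grind [G.adj_comm]⟩]
  exact card_pair h.optimal.adj.ne

theorem eq_empty_of_notMem (h : IsTight G u v a b c d) (hab : G.Adj a b)
    (hc : c ∉ commonNeighborFinset G a b) : commonNeighborFinset G a b = ∅ := by
  refine eq_empty_of_forall_notMem fun x hx => ?_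
  by_cases hd : d ∈ commonNeighborFinset G a b
  · have := (h.swap.adj_common_iff hd).1 (h.adj_of_notMem hab h.fst_mem hc hd).symm
    have := h.nodup
    grind
  · have ⟨hax, hbx⟩ := mem_commonNeighborFinset.1 hx
    have ⟨hud, hvd⟩ := mem_commonNeighborFinset.1 h.swap.fst_mem
    have := h.ne_common
    have hxC : x ∉ commonNeighborFinset G u v := by
      grind [h.mem_commonNeighborFinset_iff (x := x)]
    refine (h.degree_lt hab h.fst_mem hc hx (h.adj_of_notMem hab h.swap.fst_mem hd hx).symm
      ?_ ?_ ?_ hd).not_ge (h.degree_le ?_ ?_ hxC)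
    all_goals grind [h.not_adj_left, h.not_adj_right, G.adj_comm]

open Classical in
theorem eq_pair_of_mem (h : IsTight G u v a b c d) (hab : G.Adj a b)
    (hc : c ∈ commonNeighborFinset G a b) (hd : d ∈ commonNeighborFinset G a b) :
    commonNeighborFinset G a b = {c, d} := by
  have hle := h.degree_le_four a
  rw [h.degree_left, if_pos hab] at hle
  refine (eq_of_subset_of_card_le (insert_subset hc (singleton_subset_iff.2 hd)) ?_).symm
  rw [card_pair h.ne_common]
  omega

theorem eq_or_mem_of_adj (h : IsTight G u v a b c d) (hab : G.Adj a b) (hz : z ∉ [u, v, a, b])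
    (hzS : z ∉ commonNeighborFinset G a b) (hzy : G.Adj z y) :
    y = u ∨ y = v ∨ y ∈ commonNeighborFinset G a b := by
  grind [h.mem_of_adj hab hzy, h.symm.adj_of_adj (z := z), mem_commonNeighborFinset]

open Classical in
theorem isExceptional_of_eq_pair (h : IsTight G u v a b c d) (hpos : ∀ x, 0 < G.degree x)
    (hab : G.Adj a b) (hS : commonNeighborFinset G a b = {c, d}) : IsExceptional G := by
  have hc : c ∈ commonNeighborFinset G a b := by simp [hS]
  have hd : d ∈ commonNeighborFinset G a b := by simp [hS]
  refine isExceptional_of_map h.nodup (fun w => ?_) ?_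
  · obtain ⟨y, hwy⟩ := (G.degree_pos_iff_exists_adj w).1 (hpos w)
    have := h.eq_or_mem_of_adj hab (z := w) (y := y)
    grind [h.adj_common_iff hc (y := w), h.swap.adj_common_iff hd (y := w), h.adj_fst_iff w,
      h.adj_snd_iff w, G.adj_comm]
  · simp [h.degree_fst, h.degree_snd, ← h.degree_eq, h.degree_left, hab, hS,
      card_pair h.ne_common, h.degree_common_of_mem hc, h.swap.degree_common_of_mem hd,
      exceptionalSequences]

open Classical in
theorem isExceptional_of_eq_empty (h : IsTight G u v a b c d) (hpos : ∀ x, 0 < G.degree x)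
    (hab : G.Adj a b) (hS : commonNeighborFinset G a b = ∅) : IsExceptional G := by
  have := h.nodup
  have hmem {z y : V} (hz : z ∉ [u, v, a, b]) (hzy : G.Adj z y) : y = u ∨ y = v := by
    simpa [hS] using h.eq_or_mem_of_adj hab hz (by simp [hS]) hzy
  have hdc := h.degree_common_of_adj fun y => hmem (by grind)
  have hdd := h.swap.degree_common_of_adj fun y => hmem (by grind)
  refine isExceptional_of_map h.nodup (fun w => ?_) ?_
  · obtain ⟨y, hwy⟩ := (G.degree_pos_iff_exists_adj w).1 (hpos w)
    grind [h.adj_fst_iff w, h.adj_snd_iff w, G.adj_comm]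
  · simp [h.degree_fst, h.degree_snd, ← h.degree_eq, h.degree_left, hab, hS, hdc, hdd,
      exceptionalSequences]

theorem mem_of_adj_of_mem (h : IsTight G u v a b c d) (hab : ¬G.Adj a b)
    (hx : x ∈ commonNeighborFinset G a b) (hxy : G.Adj x y) :
    y ∈ [u, v, a, b] ∨ y ∈ commonNeighborFinset G a b := by
  by_cases hxC : x ∈ commonNeighborFinset G u v
  · rcases h.mem_commonNeighborFinset_iff.1 hxC with rfl | rfl
    · grind [(h.adj_common_iff hx).1 hxy]
    · grind [(h.swap.adj_common_iff hx).1 hxy]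
  · classical grind [h.mem_of_adj_of_notMem hab hx hxC hxy]

theorem eq_or_eq_of_adj (h : IsTight G u v a b c d) (hab : ¬G.Adj a b) (hz : z ∉ [u, v, a, b])
    (hzS : z ∉ commonNeighborFinset G a b) (hzy : G.Adj z y) : y = u ∨ y = v := by
  have ha := h.two_le_degree
  rw [h.degree_left, if_neg hab] at ha
  obtain ⟨x, hx⟩ := card_pos.1 (by omega : 0 < #(commonNeighborFinset G a b))
  have hxu : x ≠ u := fun e => h.not_adj_right (e ▸ (mem_commonNeighborFinset.1 hx).2.symm)
  have hxz := h.eq_or_adj (mem_commonNeighborFinset.1 hx).1 hxu hzy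
  have hzab : ¬G.Adj b z ∧ ¬G.Adj a z := by
    grind [h.adj_of_adj (z := z), h.symm.adj_of_adj (z := z), mem_commonNeighborFinset]
  by_contra! hy
  have hy' := h.mem_of_adj_of_mem hab hx (y := y)
  grind [h.mem_of_adj_of_mem hab (x := y) (y := z), G.adj_comm]

theorem eq_singleton_of_mem (h : IsTight G u v a b c d) (hab : ¬G.Adj a b)
    (hc : c ∈ commonNeighborFinset G a b) : commonNeighborFinset G a b = {c} := by
  refine eq_singleton_iff_unique_mem.2 ⟨hc, fun x hx => ?_⟩
  have := h.nodup
  have hx' := mem_commonNeighborFinset.1 hx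
  rcases h.eq_or_adj_of_mem hab hc hx with rfl | hcx
  · rfl
  · grind [h.adj_common_iff hc (y := x), G.irrefl, h.not_adj_left, h.not_adj_right, G.adj_comm]

open Classical in
theorem isExceptional_of_mem (h : IsTight G u v a b c d) (hpos : ∀ x, 0 < G.degree x)
    (hab : ¬G.Adj a b) (hc : c ∈ commonNeighborFinset G a b) : IsExceptional G := by
  have := h.nodup
  have hS := h.eq_singleton_of_mem hab hc
  have hmem := fun z y => h.eq_or_eq_of_adj hab (z := z) (y := y)
  have hda := h.degree_left
  rw [if_neg hab, hS, card_singleton] at hda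
  have hdd := h.swap.degree_common_of_adj fun y =>
    hmem d y (by grind) (by simp [hS, h.ne_common.symm])
  refine isExceptional_of_map (l := [u, v, c, a, b, d]) (by grind) (fun w => ?_) ?_
  · obtain ⟨y, hwy⟩ := (G.degree_pos_iff_exists_adj w).1 (hpos w)
    grind [h.adj_fst_iff w, h.adj_snd_iff w, G.adj_comm]
  · simp [h.degree_fst, h.degree_snd, hda, ← h.degree_eq, hdd, h.degree_common_of_mem hc,
      exceptionalSequences]

open Classical in
theorem isExceptional_of_notMem (h : IsTight G u v a b c d) (hpos : ∀ x, 0 < G.degree x)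
    (hab : ¬G.Adj a b) (hc : c ∉ commonNeighborFinset G a b)
    (hd : d ∉ commonNeighborFinset G a b) : IsExceptional G := by
  have := h.nodup
  have hmem := fun z y => h.eq_or_eq_of_adj hab (z := z) (y := y)
  have hdc := h.degree_common_of_adj fun y => hmem c y (by grind) hc
  have hdd := h.swap.degree_common_of_adj fun y => hmem d y (by grind) hd
  have hda : G.degree a = 2 :=
    ((h.degree_left_le_of_mem h.fst_mem).trans_eq hdc).antisymm h.two_le_degree
  obtain ⟨x, hS⟩ : ∃ x, commonNeighborFinset G a b = {x} := by
    rw [h.degree_left, if_neg hab] at hda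
    exact card_eq_one.1 (by omega)
  have hx : x ∈ commonNeighborFinset G a b := by simp [hS]
  have hxab := mem_commonNeighborFinset.1 hx
  have hnodup : [u, v, a, b, c, d, x].Nodup := by
    grind [G.irrefl, h.not_adj_left, h.not_adj_right, G.adj_comm]
  have hdx : G.degree x = 2 := by
    have hxC : x ∉ commonNeighborFinset G u v := by
      grind [h.mem_commonNeighborFinset_iff (x := x)]
    have hNx := fun y => h.mem_of_adj_of_notMem hab hx hxC (y := y)
    rw [degree_eq_card (s := {a, b}) fun y => ?_, card_pair h.ne]
    grind [G.irrefl, G.adj_comm]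
  refine isExceptional_of_map hnodup (fun w => ?_) ?_
  · obtain ⟨y, hwy⟩ := (G.degree_pos_iff_exists_adj w).1 (hpos w)
    grind [h.adj_fst_iff w, h.adj_snd_iff w, G.adj_comm]
  · simp [h.degree_fst, h.degree_snd, hda, ← h.degree_eq, hdc, hdd, hdx, exceptionalSequences]

open Classical in
theorem isExceptional (h : IsTight G u v a b c d) (hpos : ∀ x, 0 < G.degree x) :
    IsExceptional G := by
  by_cases hab : G.Adj a b
  · by_cases hc : c ∈ commonNeighborFinset G a b
    · by_cases hd : d ∈ commonNeighborFinset G a b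
      · exact h.isExceptional_of_eq_pair hpos hab (h.eq_pair_of_mem hab hc hd)
      · exact h.isExceptional_of_eq_empty hpos hab (h.swap.eq_empty_of_notMem hab hd)
    · exact h.isExceptional_of_eq_empty hpos hab (h.eq_empty_of_notMem hab hc)
  by_cases hc : c ∈ commonNeighborFinset G a b
  · exact h.isExceptional_of_mem hpos hab hc
  by_cases hd : d ∈ commonNeighborFinset G a b
  · exact h.swap.isExceptional_of_mem hpos hab hd
  · exact h.isExceptional_of_notMem hpos hab hc hd

end IsTight

section Sufficiency

variable {u v : V}

open Classical in
theorem exists_sameDegrees_adj (huv : u ≠ v) (hu : 0 < G.degree u)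
    (hv : ∀ x ≠ u, G.degree x ≤ G.degree v) : ∃ H, SameDegrees H G ∧ H.Adj u v := by
  by_cases hadj : G.Adj u v
  · exact ⟨G, fun _ => rfl, hadj⟩
  obtain ⟨w, huw⟩ := (G.degree_pos_iff_exists_adj u).1 hu
  obtain ⟨z, hvz, hwz, nzw⟩ := exists_adj_not_adj (hv w huw.ne') huw.symm
    (fun e => hadj e.symm) huv
  refine ⟨switch G u w v z, sameDegrees_switch huw hvz hadj hwz huv nzw.symm, ?_⟩
  simp [switch_adj, edge_adj, huv]

open Classical in
theorem exists_two_largest_degrees (h4 : 2 ≤ #{x | 4 ≤ G.degree x}) :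
    ∃ u v, u ≠ v ∧ 4 ≤ G.degree u ∧ 4 ≤ G.degree v ∧ (∀ x, G.degree x ≤ G.degree u) ∧
      ∀ x ≠ u, G.degree x ≤ G.degree v := by
  obtain ⟨x, -⟩ := card_pos.1 (zero_lt_two.trans_le h4)
  obtain ⟨u, -, hu⟩ := exists_max_image univ (fun w => G.degree w) ⟨x, mem_univ x⟩
  obtain ⟨z, hz, nzu⟩ := exists_mem_ne h4 u
  obtain ⟨v, hv, hmax⟩ := exists_max_image (univ.erase u) (fun w => G.degree w)
    ⟨z, mem_erase.2 ⟨nzu, mem_univ z⟩⟩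
  have hz4 := (mem_filter.1 hz).2
  exact ⟨u, v, (ne_of_mem_erase hv).symm, hz4.trans (hu z (mem_univ z)),
    hz4.trans (hmax z (mem_erase.2 ⟨nzu, mem_univ z⟩)), fun x => hu x (mem_univ x),
    fun x nxu => hmax x (mem_erase.2 ⟨nxu, mem_univ x⟩)⟩

open Classical in
theorem exists_sameDegrees_hasBook (hpos : ∀ x, 0 < G.degree x)
    (h4 : 2 ≤ #{x | 4 ≤ G.degree x}) (h2 : 5 ≤ #{x | 2 ≤ G.degree x}) (hG : ¬IsExceptional G) :
    ∃ H, SameDegrees H G ∧ HasBook H := by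
  obtain ⟨u, v, nuv, hu4, hv4, hu, hv⟩ := exists_two_largest_degrees h4
  obtain ⟨K, hK, hKuv⟩ := exists_sameDegrees_adj nuv (hpos u) hv
  obtain ⟨H, hHK, hH⟩ := exists_isOptimal hKuv
  have hHG := hHK.trans hK
  refine ⟨H, hHG, by_contra fun hbook => hG ?_⟩
  have hsame : IsExceptional H ↔ IsExceptional G := by simp only [IsExceptional, hHG _]
  simp only [← hHG _] at hpos hu4 hv4 hu hv h2
  obtain ⟨a, b, c, d, ht⟩ := exists_isTight hH hbook hu4 hv4 (fun x _ => hu x) hv h2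
  exact hsame.1 (ht.isExceptional hpos)

end Sufficiency

section Necessity

variable {u v w x : V}

open Classical in
theorem card_commonNeighborFinset_lt_degree (huv : G.Adj u v) :
    #(commonNeighborFinset G u v) < G.degree u := by
  rw [Nat.lt_iff_add_one_le, ← card_insert_of_notMem (a := v) (by simp [mem_commonNeighborFinset])]
  exact card_le_degree (by simp +contextual [huv, mem_commonNeighborFinset])

open Classical in
theorem HasBook.two_le_card (h : HasBook G) : 2 ≤ #{x | 4 ≤ G.degree x} := by
  obtain ⟨u, v, huv, hC⟩ := h
  have hu := card_commonNeighborFinset_lt_degree huv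
  have hv := card_commonNeighborFinset_lt_degree huv.symm
  rw [commonNeighborFinset_comm] at hv
  exact one_lt_card.2 ⟨u, by simp; omega, v, by simp; omega, huv.ne⟩

open Classical in
theorem card_insert_insert_commonNeighborFinset (huv : G.Adj u v) :
    #(insert u (insert v (commonNeighborFinset G u v))) = #(commonNeighborFinset G u v) + 2 := by
  rw [card_insert_of_notMem (by simp [huv.ne, mem_commonNeighborFinset]),
    card_insert_of_notMem (by simp [mem_commonNeighborFinset])]

open Classical in
theorem HasBook.five_le_card (h : HasBook G) : 5 ≤ #{x | 2 ≤ G.degree x} := by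
  obtain ⟨u, v, huv, hC⟩ := h
  have hu := card_commonNeighborFinset_lt_degree huv
  have hv := card_commonNeighborFinset_lt_degree huv.symm
  rw [commonNeighborFinset_comm] at hv
  have hpage : ∀ x ∈ commonNeighborFinset G u v, 2 ≤ G.degree x := fun x hx => by
    rw [← card_pair huv.ne]
    exact card_le_degree (by simpa [G.adj_comm x] using mem_commonNeighborFinset.1 hx)
  have hsub : insert u (insert v (commonNeighborFinset G u v)) ⊆
      ({x | 2 ≤ G.degree x} : Finset V) := by
    refine insert_subset ?_ (insert_subset ?_ fun x hx => ?_) <;> rw [mem_filter_univ]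
    exacts [by omega, by omega, hpage x hx]
  have := card_le_card hsub
  rw [card_insert_insert_commonNeighborFinset huv] at this
  omega

open Classical in
theorem eq_or_mem_of_adj_of_degree_le_four (hC : 3 ≤ #(commonNeighborFinset G u v))
    (huv : G.Adj u v) (hu : G.degree u ≤ 4) (hux : G.Adj u x) :
    x = v ∨ x ∈ commonNeighborFinset G u v := by
  refine mem_insert.1 (mem_of_degree_le (s := insert v (commonNeighborFinset G u v)) ?_ ?_ hux)
  · simp +contextual [huv, mem_commonNeighborFinset]
  · rw [card_insert_of_notMem (by simp [mem_commonNeighborFinset])]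
    omega

open Classical in
theorem degree_add_three_le (huv : G.Adj u v) (huw : ¬G.Adj u w) (hvw : ¬G.Adj v w) (nwu : w ≠ u)
    (nwv : w ≠ v) : G.degree w + 3 ≤ Fintype.card V := by
  have hle : G.degree w ≤ #(univ \ {u, v, w}) := degree_le_card (by grind [G.irrefl, G.adj_comm])
  have hcard : #{u, v, w} = 3 := card_eq_three.2 ⟨u, v, w, huv.ne, nwu.symm, nwv.symm, rfl⟩
  have := card_le_univ {u, v, w}
  rw [card_univ_sdiff] at hle
  omega

open Classical in
theorem three_le_degree_of_adj (huv : G.Adj u v) (hx : x ∈ commonNeighborFinset G u v)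
    (hwx : G.Adj w x) (nwu : w ≠ u) (nwv : w ≠ v) : 3 ≤ G.degree x := by
  obtain ⟨hux, hvx⟩ := mem_commonNeighborFinset.1 hx
  rw [← card_eq_three.2 ⟨u, v, w, huv.ne, nwu.symm, nwv.symm, rfl⟩]
  exact card_le_degree (by simp [hwx.symm, hux.symm, hvx.symm])

open Classical in
theorem degree_add_eight_le (huv : G.Adj u v) (hC : 3 ≤ #(commonNeighborFinset G u v))
    (huw : ¬G.Adj u w) (hvw : ¬G.Adj v w) (nwu : w ≠ u) (nwv : w ≠ v) :
    G.degree w + 8 ≤ Fintype.card V + #{t | 3 ≤ G.degree t} := by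
  have hle : G.degree w ≤ #(univ \ insert w (insert u (insert v (commonNeighborFinset G u v))) ∪
      ({t | 3 ≤ G.degree t} : Finset V) \ {u, v}) :=
    degree_le_card fun y hwy => by
      grind [G.irrefl, G.adj_comm, three_le_degree_of_adj huv (x := y) (w := w)]
  have hhubs : {u, v} ⊆ ({t | 3 ≤ G.degree t} : Finset V) := by
    have hu := card_commonNeighborFinset_lt_degree huv
    have hv := card_commonNeighborFinset_lt_degree huv.symm
    rw [commonNeighborFinset_comm] at hv
    refine insert_subset ?_ (singleton_subset_iff.2 ?_) <;> rw [mem_filter_univ] <;> omega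
  have hcard : #(insert w (insert u (insert v (commonNeighborFinset G u v)))) =
      #(commonNeighborFinset G u v) + 3 := by
    rw [card_insert_of_notMem (by simp [nwu, nwv, mem_commonNeighborFinset, huw]),
      card_insert_insert_commonNeighborFinset huv]
  have hcard_le := card_le_univ (insert w (insert u (insert v (commonNeighborFinset G u v))))
  have hhubs_le := card_le_card hhubs
  have hunion := hle.trans (card_union_le _ _)
  rw [card_univ_sdiff, card_sdiff_of_subset hhubs, hcard, card_pair huv.ne] at hunion
  rw [hcard] at hcard_le
  rw [card_pair huv.ne] at hhubs_le
  omega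

open Classical in
theorem IsExceptional.degree_mem_Icc (h : IsExceptional G) (x : V) :
    G.degree x ∈ Set.Icc 2 4 := by
  obtain ⟨l, hl, hG⟩ := h
  have hx : G.degree x ∈ (l : Multiset ℕ) := hG ▸ Multiset.mem_map_of_mem _ (mem_univ_val x)
  simp only [exceptionalSequences, List.mem_cons, List.not_mem_nil, or_false] at hl
  rcases hl with rfl | rfl | rfl | rfl <;>
    simp only [Multiset.mem_coe, List.mem_cons, List.not_mem_nil, or_false] at hx <;>
    exact ⟨by omega, by omega⟩

open Classical in
theorem IsExceptional.card_bounds (h : IsExceptional G) :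
    6 ≤ Fintype.card V ∧ (Fintype.card V + #{t | 3 ≤ G.degree t} ≤ 9 ∨
      Fintype.card V = 6 ∧ ∀ x, G.degree x = 4) := by
  obtain ⟨l, hl, hG⟩ := h
  have hcard : Fintype.card V = l.length := by
    simpa using congrArg Multiset.card hG
  have hcount : #{t | 3 ≤ G.degree t} = l.countP (3 ≤ ·) := by
    rw [← Multiset.coe_countP, ← hG, Multiset.countP_map]
    rfl
  have hdeg (x : V) : G.degree x ∈ l :=
    Multiset.mem_coe.1 (hG ▸ Multiset.mem_map_of_mem _ (mem_univ_val x))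
  rw [hcard, hcount]
  simp only [exceptionalSequences, List.mem_cons, List.not_mem_nil, or_false] at hl
  rcases hl with rfl | rfl | rfl | rfl
  · exact ⟨by decide, Or.inl (by decide)⟩
  · exact ⟨by decide, Or.inl (by decide)⟩
  · exact ⟨by decide, Or.inl (by decide)⟩
  · exact ⟨by decide, Or.inr ⟨rfl, fun x => by simpa using hdeg x⟩⟩

theorem HasBook.not_isExceptional (h : HasBook G) : ¬IsExceptional G := by
  classical
  intro hG
  obtain ⟨u, v, huv, hC⟩ := h
  have hdeg := hG.degree_mem_Icc
  have hu (x : V) := eq_or_mem_of_adj_of_degree_le_four (x := x) hC huv (hdeg u).2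
  have hv (x : V) := eq_or_mem_of_adj_of_degree_le_four (x := x)
    (commonNeighborFinset_comm (G := G) u v ▸ hC) huv.symm (hdeg v).2
  rw [commonNeighborFinset_comm v u] at hv
  obtain ⟨hcard, hbounds⟩ := hG.card_bounds
  obtain ⟨w, -, hw⟩ : ∃ w ∈ univ, w ∉ insert u (insert v (commonNeighborFinset G u v)) := by
    refine exists_mem_notMem_of_card_lt_card ?_
    rw [card_insert_insert_commonNeighborFinset huv, card_univ]
    have := card_commonNeighborFinset_lt_degree huv
    have := (hdeg u).2
    omega
  simp only [mem_insert, not_or] at hw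
  have huw : ¬G.Adj u w := fun e => (hu w e).elim hw.2.1 hw.2.2
  have hvw : ¬G.Adj v w := fun e => (hv w e).elim hw.1 hw.2.2
  have h3 := degree_add_three_le huv huw hvw hw.1 hw.2.1
  have h8 := degree_add_eight_le huv hC huw hvw hw.1 hw.2.1
  have := (hdeg w).1
  rcases hbounds with hle | ⟨hcard, hall⟩
  · omega
  · have := hall w
    omega

end Necessity

open Classical in
theorem exists_sameDegrees_hasBook_iff (hpos : ∀ x, 0 < G.degree x) :
    (∃ H, SameDegrees H G ∧ HasBook H) ↔
      (2 ≤ #{x | 4 ≤ G.degree x} ∧ 5 ≤ #{x | 2 ≤ G.degree x}) ∧ ¬IsExceptional G := by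
  refine ⟨?_, fun ⟨⟨h4, h2⟩, hG⟩ => exists_sameDegrees_hasBook hpos h4 h2 hG⟩
  rintro ⟨H, hH, hbook⟩
  have h := And.intro (And.intro hbook.two_le_card hbook.five_le_card) hbook.not_isExceptional
  simpa only [IsExceptional, hH _] using h

section K5MinusK3

theorem K5MinusK3_adj {i j : Fin 5} :
    K5MinusK3.Adj i j ↔ i ≠ j ∧ (3 ≤ (i : ℕ) ∨ 3 ≤ (j : ℕ)) := by
  simp only [K5MinusK3, sdiff_adj, top_adj, map_adj, and_congr_right_iff]
  refine fun hij => ⟨fun h => ?_, ?_⟩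
  · by_contra! hc
    exact h ⟨⟨i, hc.1⟩, ⟨j, hc.2⟩, fun e => hij (by simpa [Fin.ext_iff] using e), rfl, rfl⟩
  · rintro h ⟨a, b, -, rfl, rfl⟩
    simp only [Fin.castLEEmb_apply, Fin.val_castLE] at h
    omega

theorem HasBook.isContained (h : HasBook G) : K5MinusK3.IsContained G := by
  obtain ⟨u, v, huv, hC⟩ := h
  obtain ⟨x, hx, y, hy, z, hz, nxy, nxz, nyz⟩ := two_lt_card.1 hC
  obtain ⟨hux, hvx⟩ := mem_commonNeighborFinset.1 hx
  obtain ⟨huy, hvy⟩ := mem_commonNeighborFinset.1 hy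
  obtain ⟨huz, hvz⟩ := mem_commonNeighborFinset.1 hz
  refine ⟨⟨⟨![x, y, z, u, v], fun {i j} hij => ?_⟩, List.nodup_ofFn.1 ?_⟩⟩
  · rw [K5MinusK3_adj] at hij
    fin_cases i <;> fin_cases j <;> simp_all [G.adj_comm]
  · simp [nxy, nxz, nyz, hux.ne', hvx.ne', huy.ne', hvy.ne', huz.ne', hvz.ne', huv.ne]

theorem hasBook_of_isContained (h : K5MinusK3.IsContained G) : HasBook G := by
  obtain ⟨f⟩ := h
  have hadj {i j : Fin 5} (hi : 3 ≤ (i : ℕ)) (hij : i ≠ j) : G.Adj (f i) (f j) :=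
    f.toHom.map_adj (K5MinusK3_adj.2 ⟨hij, Or.inl hi⟩)
  have hpage (i : Fin 5) (hi : (i : ℕ) < 3) : f i ∈ commonNeighborFinset G (f 3) (f 4) :=
    mem_commonNeighborFinset.2 ⟨hadj (by decide) (by rintro rfl; simp at hi),
      hadj (by decide) (by rintro rfl; simp at hi)⟩
  exact ⟨f 3, f 4, hadj (by decide) (by decide), two_lt_card.2 ⟨f 0, hpage 0 (by decide), f 1,
    hpage 1 (by decide), f 2, hpage 2 (by decide), f.injective.ne (by decide),
    f.injective.ne (by decide), f.injective.ne (by decide)⟩⟩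

theorem hasBook_iff : HasBook G ↔ K5MinusK3.IsContained G :=
  ⟨HasBook.isContained, hasBook_of_isContained⟩

end K5MinusK3

section DegreeSequence

variable {n : ℕ} {d : Fin n → ℕ}

theorem le_apply_iff_lt_card (hd : Antitone d) {k : ℕ} {i : Fin n} :
    k ≤ d i ↔ (i : ℕ) < #{j | k ≤ d j} := by
  refine ⟨fun hk => ?_, fun hlt => by_contra fun hk => ?_⟩
  · have hsub : Iic i ⊆ univ.filter (k ≤ d ·) := fun j hj => by
      rw [mem_filter_univ]
      exact hk.trans (hd (mem_Iic.1 hj))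
    have hle := card_le_card hsub
    rwa [Fin.card_Iic] at hle
  · have hsub : univ.filter (k ≤ d ·) ⊆ Iio i := fun j hj => by
      rw [mem_filter_univ] at hj
      exact mem_Iio.2 (lt_of_not_ge fun hij => hk (hj.trans (hd hij)))
    exact hlt.not_ge (by simpa using card_le_card hsub)

theorem map_univ_eq_coe_iff_ofFn_eq (hd : Antitone d) {l : List ℕ} (hl : l.Pairwise (· ≥ ·)) :
    univ.val.map d = (l : Multiset ℕ) ↔ List.ofFn d = l := by
  rw [Fin.univ_val_map, Multiset.coe_eq_coe]
  refine ⟨fun h => ?_, fun h => h ▸ .refl _⟩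
  exact h.eq_of_pairwise (le := (· ≥ ·)) (fun _ _ _ _ h₁ h₂ => h₂.antisymm h₁)
    (List.pairwise_ofFn.2 fun _ _ hij => hd hij.le) hl

open Classical in
theorem isExceptional_iff {G : SimpleGraph (Fin n)} (hd : Antitone d) (hG : IsRealization G d) :
    IsExceptional G ↔ List.ofFn d ∈ exceptionalSequences := by
  have hsorted : ∀ l ∈ exceptionalSequences, l.Pairwise (· ≥ ·) := by decide
  have hdeg : (G.degree ·) = d := funext hG
  unfold IsExceptional
  rw [hdeg]
  exact ⟨fun ⟨l, hl, h⟩ => (map_univ_eq_coe_iff_ofFn_eq hd (hsorted l hl)).1 h ▸ hl,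
    fun h => ⟨_, h, (map_univ_eq_coe_iff_ofFn_eq hd (hsorted _ h)).2 rfl⟩⟩

open Classical in
theorem isPotentiallyGraphic_iff {G : SimpleGraph (Fin n)} (hd : Antitone d)
    (hG : IsRealization G d) :
    IsPotentiallyGraphic K5MinusK3 d ↔ ∃ H, SameDegrees H G ∧ HasBook H := by
  have hsame (H : SimpleGraph (Fin n)) : IsRealization H d ↔ SameDegrees H G :=
    forall_congr' fun i => by rw [hG i]
  simp only [IsPotentiallyGraphic, hd, true_and, hsame, hasBook_iff]

end DegreeSequence

theorem theorem3p3 {n : ℕ} (hn : 5 ≤ n) (d : Fin n → ℕ) (hd : IsGraphic d)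
    (hpos : ∀ i, 0 < d i) :
    IsPotentiallyGraphic K5MinusK3 d ↔
      (4 ≤ d ⟨1, by omega⟩ ∧ 2 ≤ d ⟨4, by omega⟩) ∧
      (List.ofFn d ≠ [4, 4, 2, 2, 2, 2] ∧
        List.ofFn d ≠ [4, 4, 2, 2, 2, 2, 2] ∧
        List.ofFn d ≠ [4, 4, 4, 2, 2, 2] ∧
        List.ofFn d ≠ [4, 4, 4, 4, 4, 4]) := by
  classical
  obtain ⟨hanti, G, hG⟩ := hd
  have hdeg : ∀ i, G.degree i = d i := hG
  rw [isPotentiallyGraphic_iff hanti hG,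
    exists_sameDegrees_hasBook_iff fun i => by rw [hdeg]; exact hpos i,
    isExceptional_iff hanti hG, le_apply_iff_lt_card hanti, le_apply_iff_lt_card hanti]
  simp only [hdeg, exceptionalSequences, List.mem_cons, List.not_mem_nil, or_false, not_or, ne_eq,
    Nat.lt_iff_add_one_le]
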